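/- Let $N\ge 1$ and $d$ be positive integers. For a normalized pure state $|\psi\rangle\in\mathbb C^d\otimes\mathbb C^d$ with Schmidt numbers $\lambda_0,\dots,\lambda_{d-1}$ (the eigenvalues, with multiplicity, of the reduced density matrix $\mathrm{Tr}_B|\psi\rangle\langle\psi|$), the $G$-concurrence is $G_d(|\psi\rangle)=d(\lambda_0\lambda_1\cdots\lambda_{d-1})^{1/d}$; for a mixed state $\rho$ on $\mathbb C^d\otimes\mathbb C^d$ it is the convex roof $$G_d(\rho)=\inf\Big\{\sum_i p_iG_d(|\psi_i\rangle)\ :\ \rho=\sum_i p_i|\psi_i\rangle\langle\psi_i|\Big\},$$ the infimum being over all finite ensembles $\{p_i,|\psi_i\rangle\}$ of normalized pure states that realize $\rho$. **Corollary (chain of $N$ states).** Let $\rho_{0,1},\rho_{1,2},\dots,\rho_{N-1,N}$ be density matrices on $\mathbb C^d\otimes\mathbb C^d$, where $\rho_{k-1,k}$ is shared between party $k-1$ and party $k$ of a chain of $N+1$ parties $0,1,\dots,N$. Suppose that the $N+1$ parties perform any LOCC protocol on the initial state $\rho_{0,1}\otimes\rho_{1,2}\otimes\cdots\otimes\rho_{N-1,N}$,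 that is, a protocol of finitely many rounds, in each of which one party makes a local generalized measurement (given by finitely many Kraus operators $M_r$ with $\sum_r M_r^\dagger M_r=I$) and announces the result to all parties, who may then apply local isometries depending on it; each round may depend on all earlier results, local dimensions may change during the protocol (ancillas may be added and systems discarded), and at the end an outcome $j$ from a finite set is determined by the record of all results. Suppose that the final local spaces of party $0$ and of party $N$ are $d$-dimensional. Let $\{P_j,\hat\sigma^j_{0N}\}$ be the resulting distribution of states between party $0$ and party $N$: $P_j$ is the probability of outcome $j$, and $\hat\sigma^j_{0N}$ is the final state given outcome $j$, reduced by the partial trace over all other parties (outcomes with $P_j=0$ contribute nothing to the sum below). Then $$\sum_j P_j\,G_d(\hat\sigma^j_{0N})\ \le\ G_d(\rho_{0,1})\,G_d(\rho_{1,2})\cdots G_d(\rho_{N-1,N}).$$ -/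

import Mathlib

open scoped Matrix ComplexOrder

noncomputable section

namespace QNet

/-! ### States and the G-concurrence -/

/-- Density matrices on the finite-dimensional Hilbert space `ℂ^α`. -/
def IsDensity {α : Type} [Fintype α] (ρ : Matrix α α ℂ) : Prop :=
  ρ.PosSemidef ∧ ρ.trace = 1

/-- Normalized state vectors. -/
def IsUnitVector {α : Type} [Fintype α] (ψ : α → ℂ) : Prop :=
  ∑ x, ‖ψ x‖ ^ 2 = 1

/-- The projector `|ψ⟩⟨ψ|`. -/
def proj {α : Type} (ψ : α → ℂ) : Matrix α α ℂ :=
  Matrix.vecMulVec ψ (star ψ)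

/-- The matrix of coefficients `a_{ij}` of `|ψ⟩ = ∑ a_{ij} |i⟩|j⟩`. -/
def coeffMatrix {α β : Type} (ψ : α × β → ℂ) : Matrix α β ℂ :=
  Matrix.of fun i j => ψ (i, j)

/-- The reduced density matrix `Tr_B |ψ⟩⟨ψ|`. -/
def reducedA {α β : Type} [Fintype β] (ψ : α × β → ℂ) : Matrix α α ℂ :=
  Matrix.of fun i i' => ∑ j, proj ψ (i, j) (i', j)

theorem reducedA_eq {α β : Type} [Fintype β] (ψ : α × β → ℂ) :
    reducedA ψ = coeffMatrix ψ * (coeffMatrix ψ)ᴴ := by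
  ext i i'
  simp [reducedA, proj, coeffMatrix, Matrix.vecMulVec_apply, Matrix.mul_apply]

theorem reducedA_isHermitian {α β : Type} [Fintype β] (ψ : α × β → ℂ) :
    (reducedA ψ).IsHermitian := by
  rw [reducedA_eq]
  exact Matrix.isHermitian_mul_conjTranspose_self _

/-- The Schmidt numbers of a bipartite pure state: the eigenvalues of its reduced density
matrix, with multiplicity. -/
def schmidt {α β : Type} [Fintype α] [DecidableEq α] [Fintype β] (ψ : α × β → ℂ) : α → ℝ :=
  (reducedA_isHermitian ψ).eigenvalues

/-- The G-concurrence `d (λ₀ ⋯ λ_{d-1})^{1/d}` of a pure `d × d` state. The index types `α` and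
`β` are meant to have the same number `d` of elements. -/
def pureG {α β : Type} [Fintype α] [DecidableEq α] [Fintype β] (ψ : α × β → ℂ) : ℝ :=
  (Fintype.card α : ℝ) * (∏ i, schmidt ψ i) ^ (1 / (Fintype.card α : ℝ))

/-- `ρ = ∑ i, p i |ψ i⟩⟨ψ i|` is a decomposition of `ρ` into an ensemble of pure states. -/
structure IsDecomposition {α : Type} [Fintype α] (ρ : Matrix α α ℂ)
    {n : ℕ} (p : Fin n → ℝ) (ψ : Fin n → α → ℂ) : Prop where
  nonneg : ∀ i, 0 ≤ p i
  sum_eq_one : ∑ i, p i = 1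
  unit : ∀ i, IsUnitVector (ψ i)
  eq_sum : ρ = ∑ i, (p i : ℂ) • proj (ψ i)

/-- The G-concurrence of a mixed `d × d` state: the convex roof of `pureG`. -/
def gConcurrence {α β : Type} [Fintype α] [DecidableEq α] [Fintype β]
    (ρ : Matrix (α × β) (α × β) ℂ) : ℝ :=
  sInf {g : ℝ | ∃ (n : ℕ) (p : Fin n → ℝ) (ψ : Fin n → α × β → ℂ),
    IsDecomposition ρ p ψ ∧ g = ∑ i, p i * pureG (ψ i)}

/-! ### LOCC protocols -/

/-- A finite-dimensional local Hilbert space `ℂ^(basis i)` for each party `i`. The joint space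
has the product basis `∀ i, basis i`. -/
structure Spaces (ι : Type) where
  basis : ι → Type
  [fintype : ∀ i, Fintype (basis i)]
  [decEq : ∀ i, DecidableEq (basis i)]

attribute [instance] Spaces.fintype Spaces.decEq

/-- The product basis of the joint Hilbert space of all parties. -/
abbrev Spaces.Joint {ι : Type} (H : Spaces ι) : Type := ∀ i, H.basis i

/-- The tensor product over all parties of local operators. -/
def tensorOp {ι : Type} [Fintype ι] {H H' : Spaces ι}
    (K : ∀ i, Matrix (H'.basis i) (H.basis i) ℂ) : Matrix H'.Joint H.Joint ℂ :=
  Matrix.of fun x y => ∏ i, K i (x i) (y i)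

/-- LOCC protocols of the parties `ι` that start with local spaces `H`, end with local spaces `O`
and have final classical outcomes in `J`.

A protocol is a finite tree of rounds. In a round a party `k` makes a generalized measurement
with Kraus operators `K r k` (`r` the result) and announces `r`; every other party then
applies a local isometry `K r i`, which may depend on `r` (it may be the identity, or append
an ancilla). What happens in later rounds may depend on all earlier results. Local dimensions may
change on the way. At the end of a branch an outcome `j` is declared. Several branches may
declare the same `j`, so that part of the classical record can be discarded. -/
inductive LOCC {ι : Type} [DecidableEq ι] (O : Spaces ι) (J : Type) : Spaces ι → Type 1
  | done (j : J) : LOCC O J O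
  | round {H : Spaces ι} (k : ι) (m : ℕ) (H' : Fin m → Spaces ι)
      (K : ∀ r : Fin m, ∀ i, Matrix ((H' r).basis i) (H.basis i) ℂ)
      (complete : ∑ r, (K r k)ᴴ * K r k = 1)
      (isometry : ∀ r i, i ≠ k → (K r i)ᴴ * K r i = 1)
      (next : ∀ r, LOCC O J (H' r)) : LOCC O J H

/-- The unnormalized final state for the outcome `j'` when the protocol is run on `ρ`. -/
def LOCC.run {ι : Type} [Fintype ι] [DecidableEq ι] {O : Spaces ι} {J : Type} [DecidableEq J]
    {H : Spaces ι} (L : LOCC O J H) (ρ : Matrix H.Joint H.Joint ℂ) (j' : J) :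
    Matrix O.Joint O.Joint ℂ :=
  match L with
  | .done j => if j = j' then ρ else 0
  | .round _ _ _ K _ _ next =>
      ∑ r, (next r).run (tensorOp (K r) * ρ * (tensorOp (K r))ᴴ) j'

/-- The probability of the outcome `j`. -/
def LOCC.prob {ι : Type} [Fintype ι] [DecidableEq ι] {O : Spaces ι} {J : Type} [DecidableEq J]
    {H : Spaces ι} (L : LOCC O J H) (ρ : Matrix H.Joint H.Joint ℂ) (j : J) : ℝ :=
  (L.run ρ j).trace.re

/-- The partial trace over all parties except the two distinct parties `a` and `b`. -/
def reduceTo {ι : Type} [Fintype ι] [DecidableEq ι] {O : Spaces ι} (a b : ι)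
    (ρ : Matrix O.Joint O.Joint ℂ) :
    Matrix (O.basis a × O.basis b) (O.basis a × O.basis b) ℂ :=
  Matrix.of fun u v => ∑ x : O.Joint, ∑ y : O.Joint,
    if (x a = u.1 ∧ x b = u.2) ∧ (y a = v.1 ∧ y b = v.2) ∧ (∀ i, i ≠ a → i ≠ b → x i = y i)
    then ρ x y else 0

/-- The normalized state that the parties `a` and `b` share after the outcome `j`. -/
def LOCC.sharedState {ι : Type} [Fintype ι] [DecidableEq ι] {O : Spaces ι} {J : Type}
    [DecidableEq J] {H : Spaces ι} (L : LOCC O J H) (ρ : Matrix H.Joint H.Joint ℂ) (a b : ι)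
    (j : J) : Matrix (O.basis a × O.basis b) (O.basis a × O.basis b) ℂ :=
  ((L.prob ρ j)⁻¹ : ℂ) • reduceTo a b (L.run ρ j)

/-! ### The chain -/

/-- The state number `e` of the chain consists of the qudits `(e, false)` and `(e, true)`, held by
the parties `e` and `e + 1`. -/
def holder {N : ℕ} (s : Fin N × Bool) : Fin (N + 1) :=
  if s.2 then s.1.succ else s.1.castSucc

/-- The initial local spaces: party `k` has a `d`-dimensional space for each qudit it holds. -/
def chainSpaces (N d : ℕ) : Spaces (Fin (N + 1)) where
  basis k := {s : Fin N × Bool // holder s = k} → Fin d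

/-- The index of qudit `s` in a joint basis vector. -/
def qudit {N d : ℕ} (x : (chainSpaces N d).Joint) (s : Fin N × Bool) : Fin d :=
  x (holder s) ⟨s, rfl⟩

/-- The initial state `ρ₀₁ ⊗ ρ₁₂ ⊗ ⋯ ⊗ ρ_{N-1,N}`; here `ρ e` is shared by the parties `e` and
`e + 1`. -/
def chainState {N d : ℕ} (ρ : Fin N → Matrix (Fin d × Fin d) (Fin d × Fin d) ℂ) :
    Matrix (chainSpaces N d).Joint (chainSpaces N d).Joint ℂ :=
  Matrix.of fun x y => ∏ e, ρ e (qudit x (e, false), qudit x (e, true))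
    (qudit y (e, false), qudit y (e, true))

end QNet

end

/-!
For a pure state with coefficient matrix `A`, the G-concurrence is `d |det A|^{2/d}`
(`pureG_eq_geomMeanSq`), and `|det A|^{2/d}` is multiplicative in `A`.

A protocol acts by one product Kraus operator `⊗ᵢ Kᵢ` for each branch of its tree, and these
operators form a generalized measurement (`LOCC.exists_branches`). Start with pure states of the
links, with coefficient matrices `A₀, …, A_{N-1}`, follow one branch, and let the parties between
the ends be found in the basis vectors `z` (that is how the partial trace becomes an ensemble,
`reduceTo_ends_proj`). The vector left to the ends has a coefficient matrix of the form
`U A₀ M₁ A₁ M₂ ⋯ M_{N-1} A_{N-1} Vᵀ` (`exists_contraction`), where `U` and `V` come from the Kraus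
operators of the ends, and `Mₖ` is the row `zₖ` of `Kₖ`, read as a `d × d` matrix. Hence its
G-concurrence factors. By the inequality of arithmetic and geometric means,
`|det M|^{2/d} ≤ ‖M‖² / d` in the Frobenius norm (`geomMeanSq_le`), so the sum over `z` is at most
`d ∏ₑ |det Aₑ|^{2/d} ∏ᵢ (‖Kᵢ‖² / d)` (`sum_pureG_branch_le`). Summed over the branches,
`∏ᵢ ‖Kᵢ‖² = Tr (⊗ᵢ Kᵢ)ᴴ(⊗ᵢ Kᵢ)` gives the trace of the identity, which is `d^{2N}`
(`sum_prod_norm_sq_eq_card`). The powers of `d` leave exactly `∏ₑ d |det Aₑ|^{2/d}`.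

For mixed states the bound is summed over ensembles that realize the states of the links. The
branch vectors of all members together form ensembles that realize the final states, so the
left-hand side is at most every product of values of the convex roofs, and therefore at most the
product of their infima (`le_prod_gConcurrence`).
-/

namespace QNet

/-! ### Determinants and the G-concurrence of pure states -/

/-- The geometric mean `|det M|^{2/n}` of the squared singular values of an `n × n` matrix. -/
noncomputable def geomMeanSq {γ : Type} [Fintype γ] [DecidableEq γ] (M : Matrix γ γ ℂ) : ℝ :=
  (‖M.det‖ ^ 2) ^ (1 / (Fintype.card γ : ℝ))

theorem geomMeanSq_nonneg {γ : Type} [Fintype γ] [DecidableEq γ] (M : Matrix γ γ ℂ) :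
    0 ≤ geomMeanSq M := by
  unfold geomMeanSq
  positivity

theorem geomMeanSq_mul {γ : Type} [Fintype γ] [DecidableEq γ] (M M' : Matrix γ γ ℂ) :
    geomMeanSq (M * M') = geomMeanSq M * geomMeanSq M' := by
  unfold geomMeanSq
  rw [Matrix.det_mul, norm_mul, mul_pow, Real.mul_rpow (by positivity) (by positivity)]

theorem geomMeanSq_transpose {γ : Type} [Fintype γ] [DecidableEq γ] (M : Matrix γ γ ℂ) :
    geomMeanSq Mᵀ = geomMeanSq M := by
  rw [geomMeanSq, Matrix.det_transpose, geomMeanSq]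

theorem trace_conjTranspose_mul_self {m n : Type} [Fintype m] [Fintype n] (M : Matrix m n ℂ) :
    (Mᴴ * M).trace = ((∑ i, ∑ j, ‖M i j‖ ^ 2 : ℝ) : ℂ) := by
  rw [Finset.sum_comm]
  simp [Matrix.trace, Matrix.mul_apply, Complex.conj_mul']

/-- The inequality of the arithmetic and geometric means for the squared singular values. -/
theorem geomMeanSq_le {γ : Type} [Fintype γ] [DecidableEq γ] [Nonempty γ] (M : Matrix γ γ ℂ) :
    geomMeanSq M ≤ (∑ i, ∑ j, ‖M i j‖ ^ 2) / Fintype.card γ := by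
  have hps : (Mᴴ * M).PosSemidef := Matrix.posSemidef_conjTranspose_mul_self M
  have hh := hps.isHermitian
  have hdet : ‖M.det‖ ^ 2 = ∏ i, hh.eigenvalues i := by
    have h : (Mᴴ * M).det = ∏ i, (hh.eigenvalues i : ℂ) := hh.det_eq_prod_eigenvalues
    rw [Matrix.det_mul, Matrix.det_conjTranspose, RCLike.star_def, Complex.conj_mul'] at h
    exact_mod_cast h
  have htr : ∑ i, ∑ j, ‖M i j‖ ^ 2 = ∑ i, hh.eigenvalues i := by
    have h : (Mᴴ * M).trace = ∑ i, (hh.eigenvalues i : ℂ) := hh.trace_eq_sum_eigenvalues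
    rw [trace_conjTranspose_mul_self] at h
    exact_mod_cast h
  have hc : (0 : ℝ) < Fintype.card γ := by exact_mod_cast Fintype.card_pos
  have key := Real.geom_mean_le_arith_mean_weighted Finset.univ
    (fun _ : γ => 1 / (Fintype.card γ : ℝ)) hh.eigenvalues (fun _ _ => by positivity)
    (by simp [hc.ne']) (fun i _ => hps.eigenvalues_nonneg i)
  rw [Real.finsetProd_rpow _ _ (fun i _ => hps.eigenvalues_nonneg i), ← Finset.mul_sum] at key
  rw [geomMeanSq, hdet, htr]
  convert key using 1
  ring

theorem prod_schmidt {α β : Type} [Fintype α] [DecidableEq α] [Fintype β] (ψ : α × β → ℂ) :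
    ((∏ i, schmidt ψ i : ℝ) : ℂ) = (reducedA ψ).det := by
  rw [(reducedA_isHermitian ψ).det_eq_prod_eigenvalues]
  simp [schmidt]

theorem schmidt_nonneg {α β : Type} [Fintype α] [DecidableEq α] [Fintype β] (ψ : α × β → ℂ)
    (i : α) : 0 ≤ schmidt ψ i := by
  have h : (reducedA ψ).PosSemidef := by
    rw [reducedA_eq]
    exact Matrix.posSemidef_self_mul_conjTranspose _
  exact h.eigenvalues_nonneg i

theorem pureG_nonneg {α β : Type} [Fintype α] [DecidableEq α] [Fintype β] (ψ : α × β → ℂ) :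
    0 ≤ pureG ψ :=
  mul_nonneg (Nat.cast_nonneg _)
    (Real.rpow_nonneg (Finset.prod_nonneg fun i _ => schmidt_nonneg ψ i) _)

theorem pureG_eq_geomMeanSq {α β γ : Type} [Fintype α] [DecidableEq α] [Fintype β] [Fintype γ]
    [DecidableEq γ] (e : γ ≃ α) (f : γ ≃ β) (ψ : α × β → ℂ) :
    pureG ψ = Fintype.card γ * geomMeanSq ((coeffMatrix ψ).submatrix e f) := by
  have h : ∏ i, schmidt ψ i = ‖((coeffMatrix ψ).submatrix e f).det‖ ^ 2 := by
    have h1 := prod_schmidt ψ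
    rw [reducedA_eq, ← Matrix.det_submatrix_equiv_self e, ← Matrix.submatrix_mul_equiv _ _ e f e,
      ← Matrix.conjTranspose_submatrix, Matrix.det_mul, Matrix.det_conjTranspose,
      RCLike.star_def, Complex.mul_conj'] at h1
    exact_mod_cast h1
  rw [pureG, h, geomMeanSq, Fintype.card_congr e]

theorem proj_smul {α : Type} (c : ℂ) (ψ : α → ℂ) :
    proj (c • ψ) = ((‖c‖ ^ 2 : ℝ) : ℂ) • proj ψ := by
  ext x y
  simp only [proj, Matrix.vecMulVec_apply, Matrix.smul_apply, Pi.smul_apply, Pi.star_apply,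
    smul_eq_mul, star_mul', RCLike.star_def]
  push_cast
  rw [← Complex.mul_conj']
  ring

theorem trace_proj {α : Type} [Fintype α] (ψ : α → ℂ) :
    (proj ψ).trace = ((∑ x, ‖ψ x‖ ^ 2 : ℝ) : ℂ) := by
  simp [proj, Matrix.trace, Matrix.vecMulVec_apply, Complex.mul_conj']

/-- `pureG` makes sense for unnormalized vectors, on which it is homogeneous of degree two. -/
theorem pureG_smul {α β : Type} [Fintype α] [DecidableEq α] [Fintype β] (c : ℂ)
    (ψ : α × β → ℂ) : pureG (c • ψ) = ‖c‖ ^ 2 * pureG ψ := by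
  rcases isEmpty_or_nonempty α with hα | hα
  · simp [pureG]
  have h : ∏ i, schmidt (c • ψ) i = (‖c‖ ^ 2) ^ Fintype.card α * ∏ i, schmidt ψ i := by
    have h1 : reducedA (c • ψ) = ((‖c‖ ^ 2 : ℝ) : ℂ) • reducedA ψ := by
      ext i i'
      simp only [reducedA, proj_smul, Matrix.of_apply, Matrix.smul_apply, Finset.smul_sum]
    have h2 := prod_schmidt (c • ψ)
    rw [h1, Matrix.det_smul, ← prod_schmidt] at h2
    exact_mod_cast h2
  rw [pureG, pureG, h, Real.mul_rpow (by positivity)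
    (Finset.prod_nonneg fun i _ => schmidt_nonneg ψ i), one_div,
    Real.pow_rpow_inv_natCast (by positivity) Fintype.card_ne_zero]
  ring

/-! ### The convex roof -/

/-- The average G-concurrences of the ensembles that realize `ρ`, so that `gConcurrence ρ` is
the infimum of this set. -/
def roofValues {α β : Type} [Fintype α] [DecidableEq α] [Fintype β]
    (ρ : Matrix (α × β) (α × β) ℂ) : Set ℝ :=
  {g : ℝ | ∃ (n : ℕ) (p : Fin n → ℝ) (ψ : Fin n → α × β → ℂ),
    IsDecomposition ρ p ψ ∧ g = ∑ i, p i * pureG (ψ i)}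

theorem roofValues_nonneg {α β : Type} [Fintype α] [DecidableEq α] [Fintype β]
    {ρ : Matrix (α × β) (α × β) ℂ} {g : ℝ} (hg : g ∈ roofValues ρ) : 0 ≤ g := by
  obtain ⟨n, p, ψ, h, rfl⟩ := hg
  exact Finset.sum_nonneg fun i _ => mul_nonneg (h.nonneg i) (pureG_nonneg _)

/-- An ensemble may be given by unnormalized vectors `φ i`, the weights being their squared
norms. -/
theorem gConcurrence_smul_sum_proj_le {α β κ : Type} [Fintype α] [DecidableEq α] [Fintype β]
    [DecidableEq β] [Fintype κ] (φ : κ → α × β → ℂ) {P : ℝ} (hP : 0 < P)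
    (htr : (∑ i, proj (φ i)).trace.re = P) :
    P * gConcurrence ((P : ℂ)⁻¹ • ∑ i, proj (φ i)) ≤ ∑ i, pureG (φ i) := by
  set q : κ → ℝ := fun i => ∑ x, ‖φ i x‖ ^ 2 with hq
  have hq0 : ∀ i, 0 ≤ q i := fun i => by positivity
  have hsum : ∑ i, q i = P := by
    rw [← htr, Matrix.trace_sum]
    simp only [trace_proj]
    rw [Complex.re_sum]
    simp only [Complex.ofReal_re, hq]
  -- A zero vector gets weight zero and is replaced by an arbitrary basis vector.
  have hunit : ∀ i, ∃ ψ : α × β → ℂ, IsUnitVector ψ ∧ φ i = ((√(q i) : ℝ) : ℂ) • ψ := by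
    intro i
    by_cases h : q i = 0
    · have hne : Nonempty (α × β) := by
        by_contra hcon
        rw [not_nonempty_iff] at hcon
        have : P = 0 := by
          rw [← hsum]
          exact Finset.sum_eq_zero fun i _ => by simp [hq]
        exact hP.ne' this
      obtain ⟨x⟩ := hne
      refine ⟨Pi.single x 1, ?_, ?_⟩
      · rw [IsUnitVector, Finset.sum_eq_single x]
        · simp
        · intro y _ hy
          simp [hy]
        · simp
      · have h0 : ∀ x, φ i x = 0 := by
          intro x
          have h1 := (Finset.sum_eq_zero_iff_of_nonneg
            (fun x _ => by positivity)).1 h x (Finset.mem_univ x)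
          simpa using h1
        funext x
        simp [h, h0]
    · have hs : √(q i) ≠ 0 := (Real.sqrt_pos.2 (lt_of_le_of_ne (hq0 i) (Ne.symm h))).ne'
      refine ⟨((√(q i) : ℝ) : ℂ)⁻¹ • φ i, ?_, ?_⟩
      · have h1 : ∀ x, ‖(((√(q i) : ℝ) : ℂ)⁻¹ • φ i) x‖ ^ 2 = (q i)⁻¹ * ‖φ i x‖ ^ 2 := by
          intro x
          rw [Pi.smul_apply, norm_smul, norm_inv, Complex.norm_real, Real.norm_eq_abs,
            mul_pow, inv_pow, sq_abs, Real.sq_sqrt (hq0 i)]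
        rw [IsUnitVector, Finset.sum_congr rfl fun x _ => h1 x, ← Finset.mul_sum]
        exact inv_mul_cancel₀ h
      · rw [smul_smul, mul_inv_cancel₀ (by exact_mod_cast hs), one_smul]
  choose ψ hψ hφ using hunit
  have hnorm : ∀ i, ‖((√(q i) : ℝ) : ℂ)‖ ^ 2 = q i := fun i => by
    rw [Complex.norm_real, Real.norm_eq_abs, sq_abs, Real.sq_sqrt (hq0 i)]
  have hproj : ∀ i, proj (φ i) = (q i : ℂ) • proj (ψ i) := fun i => by
    rw [hφ i, proj_smul, hnorm]
  have hG : ∀ i, pureG (φ i) = q i * pureG (ψ i) := fun i => by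
    rw [hφ i, pureG_smul, hnorm]
  let e := (Fintype.equivFin κ).symm
  have hmem : P⁻¹ * ∑ i, pureG (φ i) ∈ roofValues ((P : ℂ)⁻¹ • ∑ i, proj (φ i)) := by
    refine ⟨Fintype.card κ, fun i => P⁻¹ * q (e i), fun i => ψ (e i), ⟨?_, ?_, ?_, ?_⟩, ?_⟩
    · exact fun i => mul_nonneg (inv_nonneg.2 hP.le) (hq0 _)
    · rw [← Finset.mul_sum, e.sum_comp q, hsum, inv_mul_cancel₀ hP.ne']
    · exact fun i => hψ _
    · rw [Finset.smul_sum, ← e.sum_comp]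
      refine Finset.sum_congr rfl fun i _ => ?_
      rw [hproj, smul_smul]
      push_cast
      rfl
    · rw [Finset.mul_sum, ← e.sum_comp]
      refine Finset.sum_congr rfl fun i _ => ?_
      rw [hG, mul_assoc]
  have hle : gConcurrence ((P : ℂ)⁻¹ • ∑ i, proj (φ i)) ≤ P⁻¹ * ∑ i, pureG (φ i) :=
    csInf_le ⟨0, fun g hg => roofValues_nonneg hg⟩ hmem
  calc _ ≤ P * (P⁻¹ * ∑ i, pureG (φ i)) := mul_le_mul_of_nonneg_left hle hP.le
    _ = _ := mul_inv_cancel_left₀ hP.ne' _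

/-- The spectral decomposition is an ensemble, so the infimum is over a nonempty set. -/
theorem roofValues_nonempty {α β : Type} [Fintype α] [DecidableEq α] [Fintype β]
    [DecidableEq β] {ρ : Matrix (α × β) (α × β) ℂ} (hρ : IsDensity ρ) :
    (roofValues ρ).Nonempty := by
  have hh := hρ.1.isHermitian
  let e := (Fintype.equivFin (α × β)).symm
  refine ⟨_, Fintype.card (α × β), fun i => hh.eigenvalues (e i),
    fun i => ⇑(hh.eigenvectorBasis (e i)), ⟨?_, ?_, ?_, ?_⟩, rfl⟩
  · exact fun i => hρ.1.eigenvalues_nonneg _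
  · have h : ρ.trace = ∑ i, (hh.eigenvalues i : ℂ) := hh.trace_eq_sum_eigenvalues
    rw [hρ.2] at h
    rw [e.sum_comp hh.eigenvalues]
    exact_mod_cast h.symm
  · intro i
    have h := hh.eigenvectorBasis.orthonormal.1 (e i)
    have h2 := EuclideanSpace.norm_sq_eq (hh.eigenvectorBasis (e i))
    rw [h] at h2
    rw [IsUnitVector, ← h2, one_pow]
  · rw [e.sum_comp fun i => (hh.eigenvalues i : ℂ) • proj ⇑(hh.eigenvectorBasis i)]
    have h := hh.spectral_theorem
    ext x y
    conv_lhs => rw [h]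
    simp [Unitary.conjStarAlgAut_apply, Matrix.mul_apply, proj, Matrix.vecMulVec_apply,
      Matrix.sum_apply, Matrix.diagonal_apply, Matrix.star_apply]
    refine Finset.sum_congr rfl fun i _ => ?_
    ring

/-- The weights of an ensemble can be absorbed into its vectors. -/
theorem exists_sum_proj_of_mem_roofValues {α β : Type} [Fintype α] [DecidableEq α] [Fintype β]
    {ρ : Matrix (α × β) (α × β) ℂ} {g : ℝ} (hg : g ∈ roofValues ρ) :
    ∃ (n : ℕ) (φ : Fin n → α × β → ℂ), ρ = ∑ i, proj (φ i) ∧ g = ∑ i, pureG (φ i) := by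
  obtain ⟨n, p, ψ, h, rfl⟩ := hg
  have hnorm : ∀ i, ‖((√(p i) : ℝ) : ℂ)‖ ^ 2 = p i := fun i => by
    rw [Complex.norm_real, Real.norm_eq_abs, sq_abs, Real.sq_sqrt (h.nonneg i)]
  refine ⟨n, fun i => ((√(p i) : ℝ) : ℂ) • ψ i, ?_, ?_⟩
  · rw [h.eq_sum]
    exact Finset.sum_congr rfl fun i _ => by rw [proj_smul, hnorm]
  · exact Finset.sum_congr rfl fun i _ => by rw [pureG_smul, hnorm]

/-- A bound by all products of values of the convex roofs passes to the product of the
infima. -/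
theorem le_prod_gConcurrence {α β κ : Type} [Fintype α] [DecidableEq α] [Fintype β]
    [DecidableEq β] [Fintype κ] {ρ : κ → Matrix (α × β) (α × β) ℂ}
    (hρ : ∀ e, IsDensity (ρ e)) {c : ℝ}
    (h : ∀ g : κ → ℝ, (∀ e, g e ∈ roofValues (ρ e)) → c ≤ ∏ e, g e) :
    c ≤ ∏ e, gConcurrence (ρ e) := by
  have hseq : ∀ e, ∃ u : ℕ → ℝ, Antitone u ∧
      Filter.Tendsto u Filter.atTop (nhds (sInf (roofValues (ρ e)))) ∧
      ∀ n, u n ∈ roofValues (ρ e) := fun e =>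
    exists_seq_tendsto_sInf (roofValues_nonempty (hρ e)) ⟨0, fun g hg => roofValues_nonneg hg⟩
  choose u _ hu hmem using hseq
  exact ge_of_tendsto' (tendsto_finsetProd Finset.univ fun e _ => hu e)
    fun n => h _ fun e => hmem e n

/-! ### Product operators and the branches of a protocol -/

theorem tensorOp_mul {ι : Type} [Fintype ι] [DecidableEq ι] {H H' H'' : Spaces ι}
    (K' : ∀ i, Matrix (H''.basis i) (H'.basis i) ℂ) (K : ∀ i, Matrix (H'.basis i) (H.basis i) ℂ) :
    tensorOp K' * tensorOp K = tensorOp fun i => K' i * K i := by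
  ext x y
  simp only [tensorOp, Matrix.mul_apply, Matrix.of_apply, ← Finset.prod_mul_distrib]
  rw [Finset.prod_univ_sum, Fintype.piFinset_univ]

theorem conjTranspose_tensorOp {ι : Type} [Fintype ι] {H H' : Spaces ι}
    (K : ∀ i, Matrix (H'.basis i) (H.basis i) ℂ) :
    (tensorOp K)ᴴ = tensorOp fun i => (K i)ᴴ := by
  ext x y
  simp [tensorOp, Matrix.conjTranspose_apply]

theorem tensorOp_one {ι : Type} [Fintype ι] {H : Spaces ι} [DecidableEq H.Joint] :
    tensorOp (fun i => (1 : Matrix (H.basis i) (H.basis i) ℂ)) = 1 := by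
  ext x y
  simp only [tensorOp, Matrix.of_apply, Matrix.one_apply, Finset.prod_ite_zero,
    Finset.mem_univ, true_imp_iff, Finset.prod_const_one, funext_iff]

theorem trace_tensorOp {ι : Type} [Fintype ι] [DecidableEq ι] {H : Spaces ι}
    (K : ∀ i, Matrix (H.basis i) (H.basis i) ℂ) :
    (tensorOp K).trace = ∏ i, (K i).trace := by
  simp only [Matrix.trace, tensorOp, Matrix.diag_apply, Matrix.of_apply]
  rw [Finset.prod_univ_sum, Fintype.piFinset_univ]

/-- A measurement by one party together with isometries of the other parties is a
generalized measurement on the joint space. -/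
theorem sum_conjTranspose_tensorOp_mul_self {ι : Type} [Fintype ι] [DecidableEq ι]
    {H : Spaces ι} (k : ι) (m : ℕ) (H' : Fin m → Spaces ι)
    (K : ∀ r : Fin m, ∀ i, Matrix ((H' r).basis i) (H.basis i) ℂ)
    (complete : ∑ r, (K r k)ᴴ * K r k = 1)
    (isometry : ∀ r i, i ≠ k → (K r i)ᴴ * K r i = 1) :
    ∑ r, (tensorOp (K r))ᴴ * tensorOp (K r) = 1 := by
  simp only [conjTranspose_tensorOp, tensorOp_mul]
  ext x y
  have h : ∀ r, tensorOp (fun i => (K r i)ᴴ * K r i) x y =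
      ((K r k)ᴴ * K r k) (x k) (y k) *
        ∏ i ∈ Finset.univ.erase k, (1 : Matrix (H.basis i) (H.basis i) ℂ) (x i) (y i) := by
    intro r
    rw [tensorOp, Matrix.of_apply, ← Finset.mul_prod_erase _ _ (Finset.mem_univ k)]
    congr 1
    refine Finset.prod_congr rfl fun i hi => ?_
    rw [isometry r i (Finset.ne_of_mem_erase hi)]
  rw [Matrix.sum_apply, Finset.sum_congr rfl fun r _ => h r, ← Finset.sum_mul,
    ← Matrix.sum_apply, complete, ← tensorOp_one, tensorOp, Matrix.of_apply,
    Finset.mul_prod_erase Finset.univ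
      (fun i => (1 : Matrix (H.basis i) (H.basis i) ℂ) (x i) (y i)) (Finset.mem_univ k)]

/-- A protocol acts by finitely many product Kraus operators, one for each branch of its tree,
and these operators form a generalized measurement. -/
theorem LOCC.exists_branches {ι : Type} [Fintype ι] [DecidableEq ι] {O : Spaces ι} {J : Type}
    [DecidableEq J] {H : Spaces ι} (L : LOCC O J H) :
    ∃ (Λ : Type) (_ : Fintype Λ) (out : Λ → J)
      (K : Λ → ∀ i, Matrix (O.basis i) (H.basis i) ℂ),
      (∀ ρ j, L.run ρ j =
        ∑ l, if out l = j then tensorOp (K l) * ρ * (tensorOp (K l))ᴴ else 0) ∧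
      ∑ l, (tensorOp (K l))ᴴ * tensorOp (K l) = 1 := by
  induction L with
  | done j =>
    refine ⟨Unit, inferInstance, fun _ => j, fun _ i => 1, fun ρ j' => ?_, ?_⟩
    · simp [LOCC.run, tensorOp_one]
    · simp [tensorOp_one]
  | round k m H' K complete isometry next ih =>
    choose Λ hΛ out B hrun hcomplete using ih
    refine ⟨Σ r, Λ r, inferInstance, fun l => out l.1 l.2, fun l i => B l.1 l.2 i * K l.1 i,
      fun ρ j => ?_, ?_⟩
    · simp only [LOCC.run, hrun, Fintype.sum_sigma, ← tensorOp_mul, Matrix.conjTranspose_mul,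
        Matrix.mul_assoc]
    · rw [Fintype.sum_sigma, ← sum_conjTranspose_tensorOp_mul_self k m H' K complete isometry]
      refine Finset.sum_congr rfl fun r _ => ?_
      have h : ∀ l, (tensorOp fun i => B r l i * K r i)ᴴ * (tensorOp fun i => B r l i * K r i) =
          (tensorOp (K r))ᴴ * (((tensorOp (B r l))ᴴ * tensorOp (B r l)) * tensorOp (K r)) := by
        intro l
        rw [← tensorOp_mul, Matrix.conjTranspose_mul]
        simp only [Matrix.mul_assoc]
      rw [Finset.sum_congr rfl fun l _ => h l, ← Matrix.mul_sum, ← Matrix.sum_mul,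
        hcomplete, Matrix.one_mul]

theorem sum_prod_norm_sq_eq_card {ι Λ : Type} [Fintype ι] [DecidableEq ι] [Fintype Λ]
    {H O : Spaces ι} {K : Λ → ∀ i, Matrix (O.basis i) (H.basis i) ℂ}
    (hK : ∑ l, (tensorOp (K l))ᴴ * tensorOp (K l) = 1) :
    ∑ l, ∏ i, ∑ x, ∑ y, ‖K l i x y‖ ^ 2 = Fintype.card H.Joint := by
  have h := congrArg Matrix.trace hK
  simp only [Matrix.trace_sum, conjTranspose_tensorOp, tensorOp_mul, trace_tensorOp,
    trace_conjTranspose_mul_self, Matrix.trace_one] at h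
  exact_mod_cast h

theorem mul_proj_mul_conjTranspose {α β : Type} [Fintype α] (T : Matrix β α ℂ) (ψ : α → ℂ) :
    T * proj ψ * Tᴴ = proj (T *ᵥ ψ) := by
  rw [proj, Matrix.mul_vecMulVec, Matrix.vecMulVec_mul, proj, Matrix.star_mulVec]

/-! ### The two ends of the chain -/

/-- A joint basis vector of the parties `0, …, n + 1` consists of a basis vector for each of the
two ends and of basis vectors for the `n` parties in between. -/
def endsEquiv {n : ℕ} (O : Spaces (Fin (n + 2))) :
    ((O.basis 0 × O.basis (Fin.last (n + 1))) × ∀ k : Fin n, O.basis k.castSucc.succ) ≃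
      O.Joint where
  toFun w := Fin.cons (α := O.basis) w.1.1
    (Fin.snoc (α := fun i => O.basis i.succ) w.2 w.1.2)
  invFun x := ((x 0, x (Fin.last (n + 1))), fun k => x k.castSucc.succ)
  left_inv w := by
    refine Prod.ext (Prod.ext rfl ?_) (funext fun k => ?_)
    · change Fin.cons (α := O.basis) w.1.1
        (Fin.snoc (α := fun i => O.basis i.succ) w.2 w.1.2) (Fin.last n).succ = _
      rw [Fin.cons_succ, Fin.snoc_last]
    · simp
  right_inv x := by
    funext i
    refine Fin.cases ?_ (fun i => ?_) i
    · simp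
    · refine Fin.lastCases ?_ (fun k => ?_) i
      · change Fin.cons (α := O.basis) (x 0) (Fin.snoc (α := fun i => O.basis i.succ)
          (fun k => x k.castSucc.succ) (x (Fin.last (n + 1)))) (Fin.last n).succ = _
        rw [Fin.cons_succ, Fin.snoc_last]
        rfl
      · simp

theorem endsEquiv_zero {n : ℕ} (O : Spaces (Fin (n + 2))) (w) :
    endsEquiv O w 0 = w.1.1 :=
  congrArg (fun v => v.1.1) ((endsEquiv O).symm_apply_apply w)

theorem endsEquiv_last {n : ℕ} (O : Spaces (Fin (n + 2))) (w) :
    endsEquiv O w (Fin.last (n + 1)) = w.1.2 :=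
  congrArg (fun v => v.1.2) ((endsEquiv O).symm_apply_apply w)

theorem endsEquiv_mid {n : ℕ} (O : Spaces (Fin (n + 2))) (w) (k : Fin n) :
    endsEquiv O w k.castSucc.succ = w.2 k :=
  congrFun (congrArg Prod.snd ((endsEquiv O).symm_apply_apply w)) k

theorem reduceTo_ends {n : ℕ} {O : Spaces (Fin (n + 2))} (ρ : Matrix O.Joint O.Joint ℂ) (u v) :
    reduceTo 0 (Fin.last (n + 1)) ρ u v =
      ∑ z, ρ (endsEquiv O (u, z)) (endsEquiv O (v, z)) := by
  have hmid : ∀ w w', (∀ i, i ≠ 0 → i ≠ Fin.last (n + 1) →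
      endsEquiv O w i = endsEquiv O w' i) ↔ w.2 = w'.2 := by
    intro w w'
    constructor
    · intro h
      funext k
      have := h k.castSucc.succ (Fin.succ_ne_zero _) (by
        rw [← Fin.succ_last, Ne, Fin.succ_inj]
        exact Fin.castSucc_ne_last k)
      rwa [endsEquiv_mid, endsEquiv_mid] at this
    · intro h i h0 hl
      obtain ⟨i, rfl⟩ := Fin.exists_succ_eq.2 h0
      have hi : i ≠ Fin.last n := fun hi => hl (by rw [hi, Fin.succ_last])
      obtain ⟨k, rfl⟩ := Fin.exists_castSucc_eq.2 hi
      rw [endsEquiv_mid, endsEquiv_mid, h]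
  rw [reduceTo, Matrix.of_apply, ← (endsEquiv O).sum_comp]
  simp only [← (endsEquiv O).sum_comp (fun y => ite _ (ρ _ y) 0), endsEquiv_zero, endsEquiv_last,
    hmid, ← Prod.ext_iff]
  rw [Fintype.sum_prod_type, Finset.sum_eq_single u]
  · refine Finset.sum_congr rfl fun z _ => ?_
    rw [Finset.sum_eq_single (v, z)]
    · simp
    · rintro ⟨v', z'⟩ _ hne
      rw [if_neg]
      rintro ⟨-, h1, h2⟩
      exact hne (Prod.ext h1 h2.symm)
    · simp
  · intro u' _ hne
    refine Finset.sum_eq_zero fun z _ => Finset.sum_eq_zero fun w _ => ?_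
    rw [if_neg]
    exact fun h => hne h.1
  · simp

theorem trace_reduceTo_ends {n : ℕ} {O : Spaces (Fin (n + 2))} (ρ : Matrix O.Joint O.Joint ℂ) :
    (reduceTo 0 (Fin.last (n + 1)) ρ).trace = ρ.trace := by
  simp only [Matrix.trace, Matrix.diag_apply, reduceTo_ends]
  rw [← Fintype.sum_prod_type' (f := fun u z => ρ (endsEquiv O (u, z)) (endsEquiv O (u, z)))]
  exact (endsEquiv O).sum_comp fun x => ρ x x

/-- The partial trace of a pure state is the mixture of the pure states that remain when the
parties between the ends are found in the basis vectors `z`. -/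
theorem reduceTo_ends_proj {n : ℕ} {O : Spaces (Fin (n + 2))} (χ : O.Joint → ℂ) :
    reduceTo 0 (Fin.last (n + 1)) (proj χ) = ∑ z, proj fun u => χ (endsEquiv O (u, z)) := by
  ext u v
  simp [reduceTo_ends, Matrix.sum_apply, proj, Matrix.vecMulVec_apply]

theorem reduceTo_ends_sum {n : ℕ} {O : Spaces (Fin (n + 2))} {κ : Type} [Fintype κ]
    (ρ : κ → Matrix O.Joint O.Joint ℂ) :
    reduceTo 0 (Fin.last (n + 1)) (∑ i, ρ i) = ∑ i, reduceTo 0 (Fin.last (n + 1)) (ρ i) := by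
  ext u v
  simp only [reduceTo_ends, Matrix.sum_apply]
  exact Finset.sum_comm

/-! ### Contraction of the chain -/

/-- The sum over the paths through alternating links `A` and `M` is a product of matrices, whose
determinant is the product of the determinants. -/
theorem exists_contraction {d : ℕ} (n : ℕ) (A : Fin (n + 1) → Matrix (Fin d) (Fin d) ℂ)
    (M : Fin n → Matrix (Fin d) (Fin d) ℂ) :
    ∃ C : Matrix (Fin d) (Fin d) ℂ,
      geomMeanSq C = (∏ e, geomMeanSq (A e)) * ∏ k, geomMeanSq (M k) ∧
      ∀ u v : Fin d → ℂ, ∑ p : Fin (n + 1) → Fin d, ∑ q : Fin (n + 1) → Fin d,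
        u (p 0) * (∏ k, M k (q k.castSucc) (p k.succ)) * v (q (Fin.last n)) *
          ∏ e, A e (p e) (q e) = u ⬝ᵥ C *ᵥ v := by
  induction n with
  | zero =>
    refine ⟨A 0, by simp, fun u v => ?_⟩
    rw [← (Equiv.funUnique (Fin 1) (Fin d)).symm.sum_comp]
    simp only [← (Equiv.funUnique (Fin 1) (Fin d)).symm.sum_comp (fun q => u _ * _ * v (q _) * _)]
    simp only [dotProduct, Matrix.mulVec, Finset.mul_sum]
    refine Finset.sum_congr rfl fun a _ => Finset.sum_congr rfl fun b _ => ?_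
    simp [Equiv.funUnique]
    ring
  | succ n ih =>
    obtain ⟨C, hC, hsum⟩ := ih (fun e => A e.succ) (fun k => M k.succ)
    refine ⟨A 0 * (M 0 * C), ?_, fun u v => ?_⟩
    · rw [geomMeanSq_mul, geomMeanSq_mul, hC,
        Fin.prod_univ_succ fun e => geomMeanSq (A e), Fin.prod_univ_succ fun k => geomMeanSq (M k)]
      ring
    · have hR : u ⬝ᵥ (A 0 * (M 0 * C)) *ᵥ v =
          ∑ a, ∑ b, u a * A 0 a b * (fun c => M 0 b c) ⬝ᵥ C *ᵥ v := by
        rw [← Matrix.mulVec_mulVec, ← Matrix.mulVec_mulVec]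
        simp only [dotProduct, Matrix.mulVec, Finset.mul_sum, mul_assoc]
      rw [hR]
      simp only [← hsum]
      rw [← (Fin.consEquiv fun _ => Fin d).sum_comp, Fintype.sum_prod_type]
      refine Finset.sum_congr rfl fun a _ => ?_
      simp only [← (Fin.consEquiv fun _ => Fin d).sum_comp (fun q => u _ * _ * v (q _) * _),
        Fintype.sum_prod_type]
      rw [Finset.sum_comm]
      refine Finset.sum_congr rfl fun b _ => ?_
      rw [Finset.mul_sum]
      refine Finset.sum_congr rfl fun p _ => ?_
      rw [Finset.mul_sum]
      refine Finset.sum_congr rfl fun q _ => ?_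
      simp only [Fin.consEquiv, Equiv.coe_fn_mk, Fin.cons_zero, Fin.prod_univ_succ (n := n + 1),
        Fin.prod_univ_succ (n := n), Fin.castSucc_zero, Fin.cons_succ, ← Fin.succ_castSucc,
        ← Fin.succ_last]
      ring

/-! ### Branches of a protocol on a chain of pure states -/

/-- A joint basis vector of the chain is given by the indices of the left and of the right qudit
of each link. -/
def linkEquiv (N d : ℕ) : ((Fin N → Fin d) × (Fin N → Fin d)) ≃ (chainSpaces N d).Joint where
  toFun w := fun _ s => bif s.1.2 then w.2 s.1.1 else w.1 s.1.1
  invFun x := (fun e => qudit x (e, false), fun e => qudit x (e, true))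
  left_inv _ := rfl
  right_inv x := by
    funext k ⟨⟨e, b⟩, hs⟩
    subst hs
    cases b <;> rfl

/-- The local basis vector of an end of the chain, which holds a single qudit. -/
def endVec {n d : ℕ} (k : Fin (n + 2)) (a : Fin d) : (chainSpaces (n + 1) d).basis k :=
  fun _ => a

/-- The local basis vector of the inner party `k + 1`, which holds the right qudit of one link and
the left qudit of the next. -/
def midVec {n d : ℕ} (k : Fin n) (ab : Fin d × Fin d) :
    (chainSpaces (n + 1) d).basis k.castSucc.succ :=
  fun s => bif s.1.2 then ab.1 else ab.2

theorem endVec_zero_injective {n d : ℕ} :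
    Function.Injective (endVec (n := n) (d := d) 0) := fun _ _ h =>
  congrFun h ⟨(0, false), rfl⟩

theorem endVec_last_injective {n d : ℕ} :
    Function.Injective (endVec (n := n) (d := d) (Fin.last (n + 1))) := fun _ _ h =>
  congrFun h ⟨(Fin.last n, true), Fin.succ_last n⟩

theorem midVec_injective {n d : ℕ} (k : Fin n) :
    Function.Injective (midVec (d := d) k) := fun _ _ h =>
  Prod.ext (congrFun h ⟨(k.castSucc, true), rfl⟩) (congrFun h ⟨(k.succ, false), rfl⟩)

theorem linkEquiv_zero {n d : ℕ} (p q : Fin (n + 1) → Fin d) :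
    linkEquiv (n + 1) d (p, q) 0 = endVec 0 (p 0) := by
  funext ⟨⟨e, b⟩, hs⟩
  cases b
  · have : e = 0 := Fin.castSucc_injective _ hs
    subst this
    rfl
  · exact absurd hs (Fin.succ_ne_zero e)

theorem linkEquiv_last {n d : ℕ} (p q : Fin (n + 1) → Fin d) :
    linkEquiv (n + 1) d (p, q) (Fin.last (n + 1)) = endVec (Fin.last (n + 1)) (q (Fin.last n)) := by
  funext ⟨⟨e, b⟩, hs⟩
  cases b
  · exact absurd hs (Fin.castSucc_ne_last e)
  · have : e = Fin.last n := Fin.succ_injective _ (hs.trans (Fin.succ_last n).symm)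
    subst this
    rfl

theorem linkEquiv_mid {n d : ℕ} (p q : Fin (n + 1) → Fin d) (k : Fin n) :
    linkEquiv (n + 1) d (p, q) k.castSucc.succ = midVec k (q k.castSucc, p k.succ) := by
  funext ⟨⟨e, b⟩, hs⟩
  cases b
  · have : e = k.succ := Fin.castSucc_injective _ hs
    subst this
    rfl
  · have : e = k.castSucc := Fin.succ_injective _ hs
    subst this
    rfl

theorem card_joint_chainSpaces (N d : ℕ) :
    Fintype.card (chainSpaces N d).Joint = d ^ N * d ^ N := by
  rw [← Fintype.card_congr (linkEquiv N d)]
  simp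

/-- The product `ψ₀ ⊗ ψ₁ ⊗ ⋯` of pure states of the links. -/
def chainVec {N d : ℕ} (ψ : Fin N → Fin d × Fin d → ℂ) : (chainSpaces N d).Joint → ℂ :=
  fun x => ∏ e, ψ e (qudit x (e, false), qudit x (e, true))

theorem chainState_sum_proj {N d : ℕ} {κ : Fin N → Type} [∀ e, Fintype (κ e)]
    (φ : ∀ e, κ e → Fin d × Fin d → ℂ) :
    chainState (fun e => ∑ i, proj (φ e i)) =
      ∑ f : ∀ e, κ e, proj (chainVec fun e => φ e (f e)) := by
  ext x y
  simp only [chainState, Matrix.of_apply, Matrix.sum_apply, proj, Matrix.vecMulVec_apply,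
    chainVec, Pi.star_apply, star_prod, ← Finset.prod_mul_distrib]
  rw [Finset.prod_univ_sum, Fintype.piFinset_univ]

theorem prod_ends {n : ℕ} {M : Type} [CommMonoid M] (f : Fin (n + 2) → M) :
    ∏ i, f i = f 0 * (∏ k : Fin n, f k.castSucc.succ) * f (Fin.last (n + 1)) := by
  rw [Fin.prod_univ_succ, Fin.prod_univ_castSucc, Fin.succ_last, mul_assoc]

theorem tensorOp_mulVec_chainVec {n d : ℕ} {O : Spaces (Fin (n + 2))}
    (K : ∀ i, Matrix (O.basis i) ((chainSpaces (n + 1) d).basis i) ℂ)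
    (ψ : Fin (n + 1) → Fin d × Fin d → ℂ) (x : O.Joint) :
    (tensorOp K *ᵥ chainVec ψ) x =
      ∑ p : Fin (n + 1) → Fin d, ∑ q : Fin (n + 1) → Fin d, K 0 (x 0) (endVec 0 (p 0)) *
        (∏ k : Fin n, K k.castSucc.succ (x k.castSucc.succ)
          (midVec k (q k.castSucc, p k.succ))) *
        K (Fin.last (n + 1)) (x (Fin.last (n + 1)))
          (endVec (Fin.last (n + 1)) (q (Fin.last n))) *
        ∏ e, coeffMatrix (ψ e) (p e) (q e) := by
  rw [Matrix.mulVec, dotProduct, ← (linkEquiv (n + 1) d).sum_comp, Fintype.sum_prod_type]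
  refine Finset.sum_congr rfl fun p _ => Finset.sum_congr rfl fun q _ => ?_
  rw [tensorOp, Matrix.of_apply, prod_ends, linkEquiv_zero, linkEquiv_last]
  simp only [linkEquiv_mid]
  rfl

theorem sum_comp_le_of_injective {α β : Type} [Fintype α] [Fintype β] {g : α → β}
    (hg : Function.Injective g) {f : β → ℝ} (hf : ∀ b, 0 ≤ f b) : ∑ a, f (g a) ≤ ∑ b, f b := by
  refine (Finset.sum_map Finset.univ ⟨g, hg⟩ f).symm.trans_le ?_
  exact Finset.sum_le_sum_of_subset_of_nonneg (Finset.subset_univ _) fun b _ _ => hf b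

/-- The average G-concurrence that the ends of the chain obtain from one branch of a protocol,
whose Kraus operator is `⊗ᵢ Kᵢ`. The determinants factor along the chain, and each local factor
is bounded by the mean of the squared singular values. -/
theorem sum_pureG_branch_le {n d : ℕ} [NeZero d] {O : Spaces (Fin (n + 2))}
    (hO₀ : Fintype.card (O.basis 0) = d) (hON : Fintype.card (O.basis (Fin.last (n + 1))) = d)
    (K : ∀ i, Matrix (O.basis i) ((chainSpaces (n + 1) d).basis i) ℂ)
    (ψ : Fin (n + 1) → Fin d × Fin d → ℂ) :
    ∑ z, pureG (fun u => (tensorOp K *ᵥ chainVec ψ) (endsEquiv O (u, z))) ≤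
      d * (∏ e, geomMeanSq (coeffMatrix (ψ e))) *
        ∏ i, (∑ x, ∑ y, ‖K i x y‖ ^ 2) / (d : ℝ) := by
  let e₀ : Fin d ≃ O.basis 0 := (Fintype.equivFinOfCardEq hO₀).symm
  let e₁ : Fin d ≃ O.basis (Fin.last (n + 1)) := (Fintype.equivFinOfCardEq hON).symm
  let U : Matrix (Fin d) (Fin d) ℂ := Matrix.of fun x a => K 0 (e₀ x) (endVec 0 a)
  let V : Matrix (Fin d) (Fin d) ℂ := Matrix.of fun x a =>
    K (Fin.last (n + 1)) (e₁ x) (endVec (Fin.last (n + 1)) a)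
  let M : ∀ k : Fin n, O.basis k.castSucc.succ → Matrix (Fin d) (Fin d) ℂ := fun k x =>
    Matrix.of fun a b => K k.castSucc.succ x (midVec k (a, b))
  have hpure : ∀ z, pureG (fun u => (tensorOp K *ᵥ chainVec ψ) (endsEquiv O (u, z))) =
      d * (∏ e, geomMeanSq (coeffMatrix (ψ e))) *
        (geomMeanSq U * (∏ k, geomMeanSq (M k (z k))) * geomMeanSq V) := by
    intro z
    obtain ⟨C, hC, hsum⟩ := exists_contraction n (fun e => coeffMatrix (ψ e)) fun k => M k (z k)
    rw [pureG_eq_geomMeanSq e₀ e₁]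
    have hmat : (coeffMatrix fun u =>
        (tensorOp K *ᵥ chainVec ψ) (endsEquiv O (u, z))).submatrix e₀ e₁ = U * (C * Vᵀ) := by
      ext x y
      have h := hsum (U x) (V y)
      rw [Matrix.submatrix_apply, coeffMatrix, Matrix.of_apply, tensorOp_mulVec_chainVec,
        endsEquiv_zero, endsEquiv_last]
      simp only [endsEquiv_mid]
      exact h
    rw [hmat, geomMeanSq_mul, geomMeanSq_mul, geomMeanSq_transpose, hC, Fintype.card_fin]
    ring
  have hU : geomMeanSq U ≤ (∑ x, ∑ y, ‖K 0 x y‖ ^ 2) / (d : ℝ) := by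
    refine (geomMeanSq_le U).trans ?_
    rw [Fintype.card_fin, ← e₀.sum_comp]
    gcongr with x
    exact sum_comp_le_of_injective endVec_zero_injective
      (f := fun y => ‖K 0 (e₀ x) y‖ ^ 2) fun y => by positivity
  have hV : geomMeanSq V ≤ (∑ x, ∑ y, ‖K (Fin.last (n + 1)) x y‖ ^ 2) / (d : ℝ) := by
    refine (geomMeanSq_le V).trans ?_
    rw [Fintype.card_fin, ← e₁.sum_comp]
    gcongr with x
    exact sum_comp_le_of_injective endVec_last_injective
      (f := fun y => ‖K (Fin.last (n + 1)) (e₁ x) y‖ ^ 2) fun y => by positivity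
  have hM : ∀ k, ∑ x, geomMeanSq (M k x) ≤
      (∑ x, ∑ y, ‖K k.castSucc.succ x y‖ ^ 2) / (d : ℝ) := by
    intro k
    rw [Finset.sum_div]
    refine Finset.sum_le_sum fun x _ => (geomMeanSq_le (M k x)).trans ?_
    rw [Fintype.card_fin, ← Fintype.sum_prod_type' (f := fun a b => ‖M k x a b‖ ^ 2)]
    gcongr
    exact sum_comp_le_of_injective (midVec_injective k)
      (f := fun y => ‖K k.castSucc.succ x y‖ ^ 2) fun y => by positivity
  rw [Finset.sum_congr rfl fun z _ => hpure z, ← Finset.mul_sum]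
  refine mul_le_mul_of_nonneg_left ?_
    (mul_nonneg (Nat.cast_nonneg _) (Finset.prod_nonneg fun e _ => geomMeanSq_nonneg _))
  rw [← Finset.sum_mul, ← Finset.mul_sum, prod_ends]
  have hprod : ∑ z : ∀ k : Fin n, O.basis k.castSucc.succ, ∏ k, geomMeanSq (M k (z k)) =
      ∏ k, ∑ x, geomMeanSq (M k x) := by
    rw [Finset.prod_univ_sum, Fintype.piFinset_univ]
  rw [hprod]
  have hM0 : ∀ k, 0 ≤ ∑ x, geomMeanSq (M k x) := fun k =>
    Finset.sum_nonneg fun x _ => geomMeanSq_nonneg _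
  refine mul_le_mul (mul_le_mul hU (Finset.prod_le_prod (fun k _ => hM0 k) fun k _ => hM k)
    (Finset.prod_nonneg fun k _ => hM0 k) (by positivity)) hV (geomMeanSq_nonneg V) ?_
  exact mul_nonneg (by positivity) (Finset.prod_nonneg fun k _ => by positivity)

/-- For pure states the bound is obtained by summing over the branches of the protocol. -/
theorem sum_branches_pureG_le {n d : ℕ} [NeZero d] {O : Spaces (Fin (n + 2))}
    (hO₀ : Fintype.card (O.basis 0) = d) (hON : Fintype.card (O.basis (Fin.last (n + 1))) = d)
    {Λ : Type} [Fintype Λ]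
    {K : Λ → ∀ i, Matrix (O.basis i) ((chainSpaces (n + 1) d).basis i) ℂ}
    (hK : ∑ l, (tensorOp (K l))ᴴ * tensorOp (K l) = 1)
    (ψ : Fin (n + 1) → Fin d × Fin d → ℂ) :
    ∑ l, ∑ z, pureG (fun u => (tensorOp (K l) *ᵥ chainVec ψ) (endsEquiv O (u, z))) ≤
      ∏ e, pureG (ψ e) := by
  have hd : (d : ℝ) ≠ 0 := Nat.cast_ne_zero.2 (NeZero.ne d)
  refine (Finset.sum_le_sum fun l _ => sum_pureG_branch_le hO₀ hON (K l) ψ).trans_eq ?_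
  have hpure : ∀ e, pureG (ψ e) = d * geomMeanSq (coeffMatrix (ψ e)) := fun e => by
    rw [pureG_eq_geomMeanSq (Equiv.refl (Fin d)) (Equiv.refl (Fin d)), Fintype.card_fin]
    rfl
  simp only [hpure, Finset.prod_div_distrib, Finset.prod_mul_distrib, Finset.prod_const,
    Finset.card_univ, Fintype.card_fin]
  rw [← Finset.mul_sum, ← Finset.sum_div, sum_prod_norm_sq_eq_card hK, card_joint_chainSpaces]
  -- The normalization: `d * (d ^ (n + 1)) ^ 2 / d ^ (n + 2) = d ^ (n + 1)`.
  push_cast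
  field_simp
  ring

/-- The theorem for ensembles of unnormalized vectors that realize the given states. -/
theorem LOCC.sum_prob_mul_gConcurrence_le {n d : ℕ} [NeZero d] {O : Spaces (Fin (n + 2))}
    (hO₀ : Fintype.card (O.basis 0) = d) (hON : Fintype.card (O.basis (Fin.last (n + 1))) = d)
    {J : Type} [Fintype J] [DecidableEq J] (L : LOCC O J (chainSpaces (n + 1) d))
    {κ : Fin (n + 1) → Type} [∀ e, Fintype (κ e)] (φ : ∀ e, κ e → Fin d × Fin d → ℂ) :
    ∑ j, L.prob (chainState fun e => ∑ i, proj (φ e i)) j *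
        gConcurrence (L.sharedState (chainState fun e => ∑ i, proj (φ e i)) 0
          (Fin.last (n + 1)) j) ≤
      ∏ e, ∑ i, pureG (φ e i) := by
  obtain ⟨Λ, hΛ, out, K, hrun, hK⟩ := L.exists_branches
  rw [chainState_sum_proj]
  set ρ := ∑ f : ∀ e, κ e, proj (chainVec fun e => φ e (f e)) with hρ
  let χ : Λ → (∀ e, κ e) → (∀ k : Fin n, O.basis k.castSucc.succ) →
      O.basis 0 × O.basis (Fin.last (n + 1)) → ℂ := fun l f z u =>
    (tensorOp (K l) *ᵥ chainVec fun e => φ e (f e)) (endsEquiv O (u, z))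
  -- The shared state given `j` is the mixture over the branches that declare `j`.
  have hreduce : ∀ j, reduceTo 0 (Fin.last (n + 1)) (L.run ρ j) =
      ∑ i : {l // out l = j} × (∀ e, κ e) × (∀ k : Fin n, O.basis k.castSucc.succ),
        proj (χ i.1 i.2.1 i.2.2) := by
    intro j
    rw [hrun, ← Finset.sum_filter, Finset.sum_subtype (p := fun l => out l = j) _ (by simp),
      reduceTo_ends_sum, Fintype.sum_prod_type]
    refine Finset.sum_congr rfl fun l _ => ?_
    rw [hρ, Matrix.mul_sum, Matrix.sum_mul, reduceTo_ends_sum, Fintype.sum_prod_type]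
    refine Finset.sum_congr rfl fun f _ => ?_
    rw [mul_proj_mul_conjTranspose, reduceTo_ends_proj]
  have hj : ∀ j, L.prob ρ j * gConcurrence (L.sharedState ρ 0 (Fin.last (n + 1)) j) ≤
      ∑ l : {l // out l = j}, ∑ f, ∑ z, pureG (χ l f z) := by
    intro j
    rcases le_or_gt (L.prob ρ j) 0 with h | h
    · exact (mul_nonpos_of_nonpos_of_nonneg h
        (Real.sInf_nonneg fun g hg => roofValues_nonneg hg)).trans
        (Finset.sum_nonneg fun l _ => Finset.sum_nonneg fun f _ =>
          Finset.sum_nonneg fun z _ => pureG_nonneg _)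
    · have hle := gConcurrence_smul_sum_proj_le
        (fun i : {l // out l = j} × (∀ e, κ e) × (∀ k : Fin n, O.basis k.castSucc.succ) =>
          χ i.1 i.2.1 i.2.2) h (by rw [← hreduce, trace_reduceTo_ends]; rfl)
      rw [← hreduce, Fintype.sum_prod_type] at hle
      simp only [Fintype.sum_prod_type] at hle
      exact hle
  calc _ ≤ ∑ j, ∑ l : {l // out l = j}, ∑ f, ∑ z, pureG (χ l f z) :=
        Finset.sum_le_sum fun j _ => hj j
    _ = ∑ f, ∑ l, ∑ z, pureG (χ l f z) := by
        rw [Fintype.sum_fiberwise out fun l => ∑ f, ∑ z, pureG (χ l f z), Finset.sum_comm]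
    _ ≤ ∑ f : ∀ e, κ e, ∏ e, pureG (φ e (f e)) :=
        Finset.sum_le_sum fun f _ => sum_branches_pureG_le hO₀ hON hK _
    _ = _ := by rw [Finset.prod_univ_sum, Fintype.piFinset_univ]

end QNet

theorem mainTheorem2 (N d : ℕ) (hN : 1 ≤ N)
    (ρ : Fin N → Matrix (Fin d × Fin d) (Fin d × Fin d) ℂ)
    (hρ : ∀ e, QNet.IsDensity (ρ e))
    (O : QNet.Spaces (Fin (N + 1)))
    (hO₀ : Fintype.card (O.basis 0) = d)
    (hON : Fintype.card (O.basis (Fin.last N)) = d)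
    (J : Type) [Fintype J] [DecidableEq J]
    (L : QNet.LOCC O J (QNet.chainSpaces N d)) :
    ∑ j, L.prob (QNet.chainState ρ) j *
        QNet.gConcurrence (L.sharedState (QNet.chainState ρ) 0 (Fin.last N) j) ≤
      ∏ e, QNet.gConcurrence (ρ e) := by
  obtain ⟨n, rfl⟩ := Nat.exists_eq_add_of_le' hN
  have hd : NeZero d := ⟨by
    rintro rfl
    have h := (hρ 0).2
    simp [Matrix.trace] at h⟩
  refine QNet.le_prod_gConcurrence hρ fun g hg => ?_
  choose m φ hsum hval using fun e => QNet.exists_sum_proj_of_mem_roofValues (hg e)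
  obtain rfl : ρ = fun e => ∑ i, QNet.proj (φ e i) := funext hsum
  rw [Finset.prod_congr rfl fun e _ => hval e]
  exact L.sum_prob_mul_gConcurrence_le hO₀ hON φ
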